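/- **Model.** $n\ge 1$ processes $p_0,\dots,p_{n-1}$ form an asynchronous oriented ring. At $p_j$, port $0$ leads to $p_{j+1}$ and port $1$ to $p_{j-1}$ (indices mod $n$). Messages carry no content, are never lost, and have finite but unbounded delays. A message sent on port $0$ (received on port $1$) is clockwise; one sent on port $1$ (received on port $0$) is counter-clockwise. Processes have distinct identifiers in $\mathbb N$. For an identifier $x$, let $\mathrm{len}(x)$ be the length of its binary representation (that of $0$ being the one-bit string $0$), call its bits from the most significant one the $1$st, $2$nd, … bit, and let $\mathrm{pref}_i(x)$ be the number formed by its first $i$ bits. $\mathsf{ID}_{\min}$ is the minimum identifier and $\ell_{\min}=\mathrm{len}(\mathsf{ID}_{\min})$. **Algorithm** $\mathrm{LogarithmicLeaderElection}(\mathsf{ID},\mathsf d)$, with an integer $\mathsf d\ge 1$. Set $\mathit{count}:=0$. For $i=1,\dots,\mathrm{len}(\mathsf{ID})$: repeat {send on port $0$; receive on port $1$; $\mathit{count}:=\mathit{count}+1$} until $\mathit{count}=(2i-1)\mathsf d$. If the $i$-th bit of $\mathsf{ID}$ is $0$: send on port $1$, receive on port $0$; if moreover $i=\mathrm{len}(\mathsf{ID})$,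 send on port $1$, receive on port $0$, and return Leader. If the $i$-th bit is $1$: repeat {send on port $0$; receive on some port $q$; if $q=1$, $\mathit{count}:=\mathit{count}+1$} until $q=0$ or $\mathit{count}=2i\mathsf d$; if $q=0$, send on port $1$, execute KillACWMessageAndRelay and return Non-Leader. KillACWMessageAndRelay: set $\mathit{consecutive}:=0$, $\mathit{killed}:=0$, and repeat, until $\mathit{consecutive}=2$: receive on some port $q$; if $q=1$ and $\mathit{killed}=0$, set $\mathit{killed}:=1$ and continue with the next repetition; otherwise set $\mathit{consecutive}:=0$ if $q=1$ and $\mathit{consecutive}:=\mathit{consecutive}+1$ if $q=0$, and send on port $1-q$. **Identifier distributions.** The distribution is *$0$-ended* if the last bit of every identifier is $0$. It is *strongly prefix-free* if for any two identifiers $\mathsf{ID}_1\le \mathsf{ID}_2$, with $\ell_1=\mathrm{len}(\mathsf{ID}_1)$, one has $\mathsf{ID}_1\le \mathrm{pref}_{\ell_1}(\mathsf{ID}_2)$. For $1\le i\le \ell_{\min}$, let $A_i$ be the set of processes whose identifier minimizes $\mathrm{pref}_{i-1}$ (so $A_1$ is the set of all processes), and let $A_i^0$ and $A_i^1$ be the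 sets of processes of $A_i$ whose identifier has $i$-th bit $0$ and $1$, respectively. The distribution is *$\mathsf d$-scattered* if for each $1\le i\le\ell_{\min}$, either $A_i^0=\emptyset$, or for each $p\in A_i^1$ there are $1\le k,k'<\mathsf d$ such that the $k$-th process of $A_i$ met when moving counter-clockwise from $p$ and the $k'$-th process of $A_i$ met when moving clockwise from $p$ both belong to $A_i^0$. **Proposition.** Let $\mathsf d\ge1$, and suppose that the distribution of identifiers on the ring is $0$-ended, strongly prefix-free and $\mathsf d$-scattered, and that no identifier other than $\mathsf{ID}_{\min}$ begins with the bit string obtained from $\mathsf{ID}_{\min}$ by deleting its last bit. Then $\mathrm{LogarithmicLeaderElection}(\cdot,\mathsf d)$ is a quiescently terminating leader election algorithm: under every scheduling, every process terminates, the process with identifier $\mathsf{ID}_{\min}$ returns Leader and all others return Non-Leader, and after that no message is in transit; moreover, the leader is the last process to terminate. During the execution, each process sends exactly $(2\,\mathrm{len}(\mathsf{ID}_{\min})-1)\,\mathsf d$ clockwise messages and at most $\mathrm{len}(\mathsf{ID}_{\min})+1$ counter-clockwise messages. If $\mathsf{ID}_{\min}>0$, these numbers are at most $C\,\mathsf d\log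 \mathsf{ID}_{\min}$ and $C\log\mathsf{ID}_{\min}$, respectively, where $C$ is an absolute constant. -/

import Mathlib

namespace ContentOblivious

/-! ### Content-oblivious oriented rings -/

/-- The two local ports. At process `p`, port `0` leads to `p + 1`, port `1` leads to `p - 1`.
A clockwise (CW) message is sent on port `0` and received on port `1`; a counter-clockwise (CCW)
message is sent on port `1` and received on port `0`. -/
inductive Port
  | zero
  | one

/-- The port `1 - q`. -/
def Port.other : Port → Port
  | .zero => .one
  | .one => .zero

/-- What a process has returned. The value `undecided` stands for leaving the program without
returning a decision. -/
inductive Verdict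
  | leader
  | nonLeader
  | undecided

/-- The next instruction of a process, together with the local state(s) after it. Messages carry no
content: a receiver learns at most the port on which the message arrived. -/
inductive Instr (σ : Type)
  /-- send a message on port `q` -/
  | send (q : Port) (next : σ)
  /-- block until a message is available on port `q`, and receive it -/
  | receive (q : Port) (next : σ)
  /-- block until a message is available on some port, and receive one, on a port `q` -/
  | receiveAny (next : Port → σ)
  /-- the process has terminated -/
  | halt (v : Verdict)

/-- A local program: an initial state and the instruction to be executed in each local state. -/
structure Program (σ : Type) where
  start : σ
  instr : σ → Instr σ

/-- A global configuration of a ring of `n` processes. A message counts as in transit from the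
moment it is sent until its destination retrieves it with a receive instruction. -/
structure Config (n : ℕ) (σ : Type) where
  /-- local states -/
  state : Fin n → σ
  /-- `cw p`: number of clockwise messages in transit from `p` to `p + 1` -/
  cw : Fin n → ℕ
  /-- `ccw p`: number of counter-clockwise messages in transit from `p` to `p - 1` -/
  ccw : Fin n → ℕ
  /-- `cwSent p`: number of clockwise messages sent by `p` so far -/
  cwSent : Fin n → ℕ
  /-- `ccwSent p`: number of counter-clockwise messages sent by `p` so far -/
  ccwSent : Fin n → ℕ

namespace Config

variable {n : ℕ} [NeZero n] {σ : Type}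

/-- The number of messages that are waiting to be received by `p` on port `q`. -/
def inbox (c : Config n σ) (p : Fin n) : Port → ℕ
  | .zero => c.ccw (p + 1)
  | .one => c.cw (p - 1)

/-- `p` sends a message on the given port and moves to the local state `s`. -/
def send (c : Config n σ) (p : Fin n) (s : σ) : Port → Config n σ
  | .zero =>
      { c with
        state := Function.update c.state p s
        cw := Function.update c.cw p (c.cw p + 1)
        cwSent := Function.update c.cwSent p (c.cwSent p + 1) }
  | .one =>
      { c with
        state := Function.update c.state p s
        ccw := Function.update c.ccw p (c.ccw p + 1)
        ccwSent := Function.update c.ccwSent p (c.ccwSent p + 1) }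

/-- `p` receives a message on the given port and moves to the local state `s`. -/
def receive (c : Config n σ) (p : Fin n) (s : σ) : Port → Config n σ
  | .zero =>
      { c with
        state := Function.update c.state p s
        ccw := Function.update c.ccw (p + 1) (c.ccw (p + 1) - 1) }
  | .one =>
      { c with
        state := Function.update c.state p s
        cw := Function.update c.cw (p - 1) (c.cw (p - 1) - 1) }

/-- No message is in transit. -/
def Quiet (c : Config n σ) : Prop :=
  ∀ p, c.cw p = 0 ∧ c.ccw p = 0

end Config

section Executions

variable {n : ℕ} [NeZero n] {σ : Type}

/-- The initial configuration: every process is in its initial state, nothing has been sent. -/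
def initial (P : Fin n → Program σ) : Config n σ where
  state p := (P p).start
  cw _ := 0
  ccw _ := 0
  cwSent _ := 0
  ccwSent _ := 0

/-- One asynchronous step: the scheduler picks a process `p` whose next instruction can be executed
(and, when `p` accepts a message from either port, one of the ports with a message), and `p`
executes this instruction. -/
inductive Step (P : Fin n → Program σ) (c : Config n σ) : Config n σ → Prop
  | send (p : Fin n) (q : Port) (s : σ) (h : (P p).instr (c.state p) = .send q s) :
      Step P c (c.send p s q)
  | receive (p : Fin n) (q : Port) (s : σ) (h : (P p).instr (c.state p) = .receive q s)
      (hq : 0 < c.inbox p q) : Step P c (c.receive p s q)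
  | receiveAny (p : Fin n) (q : Port) (f : Port → σ) (h : (P p).instr (c.state p) = .receiveAny f)
      (hq : 0 < c.inbox p q) : Step P c (c.receive p (f q) q)

/-- `c` occurs in some execution. -/
def Reachable (P : Fin n → Program σ) (c : Config n σ) : Prop :=
  Relation.ReflTransGen (Step P) (initial P) c

/-- No process can execute any further instruction in `c`. -/
def Stuck (P : Fin n → Program σ) (c : Config n σ) : Prop :=
  ∀ c', ¬ Step P c c'

/-- `p` has terminated in `c` and has returned `v`. -/
def Returned (P : Fin n → Program σ) (c : Config n σ) (p : Fin n) (v : Verdict) : Prop :=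
  (P p).instr (c.state p) = .halt v

/-- The programs `P` solve leader election with quiescent termination and elect `p₀`, under every
scheduling of the processes and of the message deliveries: every execution is finite, and one that
cannot be continued (so that every message that can be received has been received and every process
has executed all that it could) has ended with all processes terminated, `p₀` as the leader, all
others as non-leaders, and no message in transit. Moreover, the leader is the last process to
terminate: when it terminates, the others have already terminated and no message is in transit. -/
structure QuiescentlyElects (P : Fin n → Program σ) (p₀ : Fin n) : Prop where
  finite : ¬ ∃ e : ℕ → Config n σ, e 0 = initial P ∧ ∀ t, Step P (e t) (e (t + 1))
  elected : ∀ c, Reachable P c → Stuck P c →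
    Returned P c p₀ .leader ∧ (∀ p, p ≠ p₀ → Returned P c p .nonLeader) ∧ c.Quiet
  leader_last : ∀ c v, Reachable P c → Returned P c p₀ v →
    (∀ p, p ≠ p₀ → Returned P c p .nonLeader) ∧ c.Quiet

end Executions

/-! ### Identifiers -/

/-- The length of the binary representation of `x` (the representation of `0` being the
one-bit string `0`). -/
def len (x : ℕ) : ℕ := Nat.log 2 x + 1

/-- The number represented by the first `i` bits of `x`, for `i ≤ len x`. -/
def pref (i x : ℕ) : ℕ := x / 2 ^ (len x - i)

/-- The `i`-th bit of `x` is `1`, for `1 ≤ i ≤ len x`; bits are counted from the most significant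
one. -/
def bit (x i : ℕ) : Bool := x.testBit (len x - i)

section Distributions

variable {n : ℕ} [NeZero n]

/-- The last bit of each identifier is `0`. -/
def ZeroEnded (ID : Fin n → ℕ) : Prop :=
  ∀ p, bit (ID p) (len (ID p)) = false

/-- For any two identifiers `ID₁ ≤ ID₂`, with `ℓ₁ = len ID₁`, one has `ID₁ ≤ pref ℓ₁ ID₂`. -/
def StronglyPrefixFree (ID : Fin n → ℕ) : Prop :=
  ∀ p q, ID p ≤ ID q → ID p ≤ pref (len (ID p)) (ID q)

/-- The set `A_i`, for `1 ≤ i`: the processes for which the number formed by the bits that precede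
the `i`-th one is minimum. In particular `A_1` is the set of all processes. -/
def A (ID : Fin n → ℕ) (i : ℕ) : Set (Fin n) :=
  {p | ∀ q, pref (i - 1) (ID p) ≤ pref (i - 1) (ID q)}

/-- The set `A_i^0` of the processes of `A_i` whose `i`-th bit is `0`. -/
def A0 (ID : Fin n → ℕ) (i : ℕ) : Set (Fin n) :=
  {p ∈ A ID i | bit (ID p) i = false}

/-- The set `A_i^1` of the processes of `A_i` whose `i`-th bit is `1`. -/
def A1 (ID : Fin n → ℕ) (i : ℕ) : Set (Fin n) :=
  {p ∈ A ID i | bit (ID p) i = true}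

/-- The first process of `S` encountered when moving clockwise from `p` (possibly `p` itself, after
a full turn). The `k`-th one is `(suc S)^[k] p`. -/
noncomputable def suc (S : Set (Fin n)) (p : Fin n) : Fin n :=
  p + Fin.ofNat n (sInf {t : ℕ | 0 < t ∧ p + Fin.ofNat n t ∈ S})

/-- The first process of `S` encountered when moving counter-clockwise from `p` (possibly `p`
itself, after a full turn). The `k`-th one is `(pred S)^[k] p`. -/
noncomputable def pred (S : Set (Fin n)) (p : Fin n) : Fin n :=
  p - Fin.ofNat n (sInf {t : ℕ | 0 < t ∧ p - Fin.ofNat n t ∈ S})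

/-- The minimum identifier. -/
noncomputable def idMin (ID : Fin n → ℕ) : ℕ := ⨅ p, ID p

/-- The distribution of identifiers is `d`-scattered. -/
def Scattered (d : ℕ) (ID : Fin n → ℕ) : Prop :=
  ∀ i, 1 ≤ i → i ≤ len (idMin ID) →
    A0 ID i = ∅ ∨
      ∀ p ∈ A1 ID i,
        (∃ k, 1 ≤ k ∧ k < d ∧ (pred (A ID i))^[k] p ∈ A0 ID i) ∧
        (∃ k, 1 ≤ k ∧ k < d ∧ (suc (A ID i))^[k] p ∈ A0 ID i)

end Distributions

/-! ### The algorithm `LogarithmicLeaderElection(ID, d)`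

```
count := 0
for i = 1 to len(ID)
  b := i-th bit of ID
  repeat                                                       (Synchronization)
    send on port 0; receive on port 1; count := count + 1
  until count = (2i - 1) d
  if b = 0 then
    send on port 1; receive on port 0                          (Zero Signaling)
    if i = len(ID) then
      send on port 1; receive on port 0; return Leader         (Termination)
  else
    repeat                                                     (No-Zero Checking)
      send on port 0; receive on a port q
      if q = 1 then count := count + 1
    until q = 0 or count = 2 i d
    if q = 0 then                                              (Inactive)
      send on port 1; KillACWMessageAndRelay(); return Non-Leader

KillACWMessageAndRelay():
  consecutive := 0; killed := 0
  repeat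
    receive on a port q
    if q = 1 then
      if killed = 0 then killed := 1; continue
      consecutive := 0
    else consecutive := consecutive + 1
    send on port 1 - q
  until consecutive = 2
```
-/

/-- Local states: the position in the pseudocode of the next send or receive instruction, together
with the values of the local variables that are still needed. -/
inductive LState
  | syncSend (i count : ℕ)
  | syncReceive (i count : ℕ)
  | zeroSend (i count : ℕ)
  | zeroReceive (i count : ℕ)
  | termSend
  | termReceive
  | checkSend (i count : ℕ)
  | checkReceive (i count : ℕ)
  /-- the send on port `1` that precedes `KillACWMessageAndRelay` -/
  | forward
  | relayReceive (killed : Bool) (consecutive : ℕ)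
  /-- the send on port `1 - q` in `KillACWMessageAndRelay` -/
  | relaySend (q : Port) (killed : Bool) (consecutive : ℕ)
  | returned (v : Verdict)

/-- The beginning of the `i`-th iteration of the main loop, if there is one. -/
def enterRound (ID i count : ℕ) : LState :=
  if i ≤ len ID then .syncSend i count else .returned .undecided

/-- The instructions of `LogarithmicLeaderElection(ID, d)`. -/
def logInstr (ID d : ℕ) : LState → Instr LState
  | .syncSend i count => .send .zero (.syncReceive i count)
  | .syncReceive i count =>
      .receive .one
        (if count + 1 = (2 * i - 1) * d then
          if bit ID i = false then .zeroSend i (count + 1) else .checkSend i (count + 1)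
        else .syncSend i (count + 1))
  | .zeroSend i count => .send .one (.zeroReceive i count)
  | .zeroReceive i count =>
      .receive .zero (if i = len ID then .termSend else enterRound ID (i + 1) count)
  | .termSend => .send .one .termReceive
  | .termReceive => .receive .zero (.returned .leader)
  | .checkSend i count => .send .zero (.checkReceive i count)
  | .checkReceive i count =>
      .receiveAny fun
        | .zero => .forward
        | .one =>
            if count + 1 = 2 * i * d then enterRound ID (i + 1) (count + 1)
            else .checkSend i (count + 1)
  | .forward => .send .one (.relayReceive false 0)
  | .relayReceive killed consecutive =>
      .receiveAny fun
        | .one =>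
            if killed = false then .relayReceive true consecutive else .relaySend .one killed 0
        | .zero => .relaySend .zero killed (consecutive + 1)
  | .relaySend q killed consecutive =>
      .send q.other
        (if consecutive = 2 then .returned .nonLeader else .relayReceive killed consecutive)
  | .returned v => .halt v

/-- The algorithm `LogarithmicLeaderElection(ID, d)`. It depends on the identifier of the process
and on the parameter `d` only. -/
def logarithmicLeaderElection (ID d : ℕ) : Program LState where
  start := enterRound ID 1 0
  instr := logInstr ID d

end ContentOblivious

namespace ContentOblivious

/-! ### Prefixes and bits -/

/-! By prefix minimality, an active process never has bit 0 in a round where `p₀` has bit 1. Each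
round in which `p₀` has bit 0 carries one wave of counter-clockwise messages, one per process, and
`zeros` numbers these waves. After the last wave `p₀` starts one more, the termination wave.

Safety rests on two bounds that tie the counters of a process together (`Sound`). Whoever has sent
its message of wave `i` has received at least `(2i-1)d` clockwise messages. Whoever has not yet
received its message of wave `i` has sent at most `(2i-1)d` plus a lag. The lag arises because a
process signalling 0 stops at `(2i-1)d`, an active process with bit 1 can run one message ahead of
its counter-clockwise neighbour, and an earlier dropout cannot run ahead at all. Scattering makes
the lag smaller than `d`, so a process with bit 1 cannot reach `2id` before the wave knocks it out.
The surplus message of each dropout is the one it later kills. Between two ordinary waves a relay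
must forward a clockwise message, whereas the clockwise budget `(2ℓ-1)d` is used up before the
termination wave; hence two consecutive counter-clockwise messages mean termination. These arguments
are `possible_receive_one`, `possible_receive_zero`, `sound_send_zero` and `sound_send_one`.

For liveness, a potential bounds the length of executions. In a stuck configuration, a process with
the fewest clockwise sends leads to one waiting for a wave at that minimum, and following the wave
clockwise around the ring shows that it cannot be missing (`Stuck.lt_ccwSent`). The termination wave
then goes all the way round (`Stuck.received_of_sent`), and `Invariant.final` reads off the outcome.
-/

theorem len_pos (x : ℕ) : 1 ≤ len x := Nat.le_add_left _ _

theorem len_mono {x y : ℕ} (h : x ≤ y) : len x ≤ len y :=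
  Nat.add_le_add_right (Nat.log_mono_right h) 1

theorem pref_zero (x : ℕ) : pref 0 x = 0 :=
  Nat.div_eq_of_lt (by simpa [len] using Nat.lt_pow_succ_log_self (by norm_num) x)

theorem pref_eq_div {i j x : ℕ} (hij : i ≤ j) (hj : j ≤ len x) :
    pref i x = pref j x / 2 ^ (j - i) := by
  rw [pref, pref, Nat.div_div_eq_div_mul, ← pow_add]
  congr 2
  omega

theorem pref_len (x : ℕ) : pref (len x) x = x := by simp [pref]

theorem pref_eq_bit {i x : ℕ} (hi : 1 ≤ i) (hx : i ≤ len x) :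
    pref i x = 2 * pref (i - 1) x + (bit x i).toNat := by
  rw [pref_eq_div (Nat.sub_le i 1) hx, Nat.sub_sub_self hi, bit, Nat.toNat_testBit, ← pref]
  omega

/-- The number of zeros among the first `i` bits of `x`. -/
def zeros (x : ℕ) : ℕ → ℕ
  | 0 => 0
  | i + 1 => zeros x i + if bit x (i + 1) = false then 1 else 0

theorem zeros_of_false {x i : ℕ} (hi : 1 ≤ i) (h : bit x i = false) :
    zeros x i = zeros x (i - 1) + 1 := by
  obtain ⟨j, rfl⟩ := Nat.exists_eq_add_of_le' hi
  simp [zeros, h]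

theorem zeros_of_true {x i : ℕ} (hi : 1 ≤ i) (h : bit x i = true) :
    zeros x i = zeros x (i - 1) := by
  obtain ⟨j, rfl⟩ := Nat.exists_eq_add_of_le' hi
  simp [zeros, h]

theorem zeros_mono (x : ℕ) : Monotone (zeros x) :=
  monotone_nat_of_le_succ fun _ => Nat.le_add_right _ _

theorem zeros_le (x i : ℕ) : zeros x i ≤ i := by
  induction i with
  | zero => simp [zeros]
  | succ i ih => rw [zeros]; split_ifs <;> omega

theorem zeros_lt {x i j : ℕ} (hij : i < j) (h : bit x j = false) : zeros x i < zeros x j := by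
  have := zeros_mono x (Nat.le_sub_one_of_lt hij)
  have := zeros_of_false (by omega : 1 ≤ j) h
  omega

theorem lt_of_zeros_lt {x i j : ℕ} (h : zeros x i < zeros x j) : i < j :=
  (zeros_mono x).reflect_lt h

/-- A discrete intermediate value argument. It recovers the round of a wave from its rank among the
counter-clockwise messages. -/
theorem exists_zeros_eq {x j l : ℕ} (hj : 1 ≤ j) (hl : j ≤ zeros x l) :
    ∃ i, 1 ≤ i ∧ i ≤ l ∧ bit x i = false ∧ zeros x i = j := by
  induction l with
  | zero => simp [zeros] at hl; omega
  | succ l ih =>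
    by_cases h : j ≤ zeros x l
    · obtain ⟨i, h1, h2, h3⟩ := ih h
      exact ⟨i, h1, by omega, h3⟩
    · have hb : bit x (l + 1) = false := by
        by_contra hb
        simp [zeros, hb] at hl
        omega
      refine ⟨l + 1, by omega, le_rfl, hb, ?_⟩
      simp only [zeros, hb, if_true] at hl ⊢
      omega

/-! ### Moving around the ring -/

section Ring

variable {n : ℕ} [NeZero n]

theorem forall_of_forall_add_one {P : Fin n → Prop} {p : Fin n} (hp : P p)
    (h : ∀ u, P u → P (u + 1)) (q : Fin n) : P q := by
  have key : ∀ k : ℕ, P (p + Fin.ofNat n k) := by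
    intro k
    induction k with
    | zero => simpa using hp
    | succ k ih =>
      have : p + Fin.ofNat n (k + 1) = p + Fin.ofNat n k + 1 := by
        rw [add_assoc]; congr 1; ext; simp [Fin.val_add]
      rw [this]
      exact h _ ih
  have := key (q - p).val
  simpa using this

theorem forall_of_forall_sub_one {P : Fin n → Prop} {p : Fin n} (hp : P p)
    (h : ∀ u, P u → P (u - 1)) (q : Fin n) : P q := by
  have := forall_of_forall_add_one (P := fun u => P (-u)) (p := -p) (by simpa using hp)
    (fun u hu => by
      have := h _ hu
      rwa [show -(u + 1) = -u - 1 by abel]) (-q)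
  simpa using this

theorem exists_sub_ofNat_mem {S : Set (Fin n)} (hS : S.Nonempty) (p : Fin n) :
    {t : ℕ | 0 < t ∧ p - Fin.ofNat n t ∈ S}.Nonempty := by
  obtain ⟨q, hq⟩ := hS
  -- The extra full turn keeps the distance positive when `q = p`.
  refine ⟨(p - q).val + n, Nat.add_pos_right _ (NeZero.pos n), ?_⟩
  have : Fin.ofNat n ((p - q).val + n) = p - q := by ext; simp [Nat.mod_eq_of_lt]
  rw [this]
  simpa using hq

theorem pred_mem {S : Set (Fin n)} (hS : S.Nonempty) (p : Fin n) : pred S p ∈ S :=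
  (Nat.sInf_mem (exists_sub_ofNat_mem hS p)).2

theorem pred_eq_sub_one {S : Set (Fin n)} {p : Fin n} (h : p - 1 ∈ S) : pred S p = p - 1 := by
  have h1 : Fin.ofNat n 1 = 1 := rfl
  have : sInf {t : ℕ | 0 < t ∧ p - Fin.ofNat n t ∈ S} = 1 := by
    refine le_antisymm (Nat.sInf_le ⟨one_pos, by rwa [h1]⟩) ?_
    exact (Nat.sInf_mem (⟨1, one_pos, by rwa [h1]⟩ :
      {t : ℕ | 0 < t ∧ p - Fin.ofNat n t ∈ S}.Nonempty)).1
  rw [pred, this, h1]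

theorem pred_sub_one {S : Set (Fin n)} {p : Fin n} (hS : S.Nonempty) (h : p - 1 ∉ S) :
    pred S (p - 1) = pred S p := by
  have hs : ∀ t : ℕ, p - 1 - Fin.ofNat n t = p - Fin.ofNat n (t + 1) := by
    intro t
    rw [sub_sub]; congr 1; ext; simp [Fin.val_add, add_comm]
  have key : sInf {t : ℕ | 0 < t ∧ p - Fin.ofNat n t ∈ S} =
      sInf {t : ℕ | 0 < t ∧ p - 1 - Fin.ofNat n t ∈ S} + 1 := by
    refine le_antisymm (Nat.sInf_le ?_) ?_
    · have := Nat.sInf_mem (exists_sub_ofNat_mem hS (p - 1))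
      exact ⟨Nat.succ_pos _, by rw [← hs]; exact this.2⟩
    · obtain ⟨h1, h2⟩ := Nat.sInf_mem (exists_sub_ofNat_mem hS p)
      generalize sInf {t : ℕ | 0 < t ∧ p - Fin.ofNat n t ∈ S} = t at h1 h2 ⊢
      obtain ⟨t, rfl⟩ := Nat.exists_eq_add_of_le' h1
      rw [← hs] at h2
      refine Nat.succ_le_succ (Nat.sInf_le ⟨?_, h2⟩)
      -- Distance 0 from `p - 1` would put `p - 1` in `S`.
      rcases Nat.eq_zero_or_pos t with rfl | ht
      · exact absurd (by simpa using h2) h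
      · exact ht
  rw [pred, pred, key, hs]

/-- The number of elements of `S` met when moving counter-clockwise from `u`, which is counted if it
belongs to `S`, until an element of `T ⊆ S` is met, which is not counted. -/
noncomputable def lag (S T : Set (Fin n)) (u : Fin n) : ℕ :=
  open Classical in
  if u ∈ S then sInf {k | (pred S)^[k] u ∈ T} else sInf {k | (pred S)^[k] (pred S u) ∈ T}

variable {S T : Set (Fin n)} {d : ℕ}

theorem lag_lt (hd : 1 ≤ d) (hS : S.Nonempty)
    (h : ∀ p ∈ S, p ∉ T → ∃ k, 1 ≤ k ∧ k < d ∧ (pred S)^[k] p ∈ T) (u : Fin n) :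
    lag S T u < d := by
  have key : ∀ p ∈ S, sInf {k | (pred S)^[k] p ∈ T} < d := by
    intro p hp
    by_cases hT : p ∈ T
    · exact lt_of_le_of_lt (Nat.sInf_le (show (pred S)^[0] p ∈ T from hT)) hd
    · obtain ⟨k, -, hk, hk'⟩ := h p hp hT
      exact lt_of_le_of_lt (Nat.sInf_le hk') hk
  unfold lag
  split_ifs with hu
  · exact key _ hu
  · exact key _ (pred_mem hS u)

theorem lag_sub_one (hS : S.Nonempty) (u : Fin n) :
    lag S T (u - 1) = sInf {k | (pred S)^[k] (pred S u) ∈ T} := by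
  unfold lag
  split_ifs with hu
  · rw [pred_eq_sub_one hu]
  · rw [pred_sub_one hS hu]

theorem lag_of_notMem (hS : S.Nonempty) {u : Fin n} (hu : u ∉ S) :
    lag S T (u - 1) = lag S T u := by
  rw [lag_sub_one hS, lag, if_neg hu]

/-- As `u` itself is not in `T`, the walk from `u` takes one step to `pred S u` and continues as the
walk that defines the lag at `u - 1`. This increment pays for the one message by which `u` may run
ahead. -/
theorem lag_add_one_le (hS : S.Nonempty) {u : Fin n} (hu : u ∈ S) (hT : u ∉ T)
    (h : ∃ k, (pred S)^[k] u ∈ T) : lag S T (u - 1) + 1 ≤ lag S T u := by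
  rw [lag_sub_one hS, lag, if_pos hu]
  -- Existence matters: the infimum of an empty set would be 0.
  have hm : (pred S)^[sInf {k | (pred S)^[k] u ∈ T}] u ∈ T := Nat.sInf_mem h
  generalize sInf {k | (pred S)^[k] u ∈ T} = k at hm ⊢
  cases k with
  | zero => exact absurd hm hT
  | succ k => exact Nat.succ_le_succ (Nat.sInf_le hm)

end Ring

/-! ### The assumptions, as they are used in the analysis -/

section Analysis

variable {n : ℕ} [NeZero n]

/-- The identifier of `u` agrees with that of `p₀` on the bits that precede the `i`-th one. -/
def Agree (ID : Fin n → ℕ) (p₀ : Fin n) (i : ℕ) (u : Fin n) : Prop :=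
  pref (i - 1) (ID u) = pref (i - 1) (ID p₀)

/-- The `i`-th bit of the identifier of `p₀` exists and is `0`. -/
def Wave (ID : Fin n → ℕ) (p₀ : Fin n) (i : ℕ) : Prop :=
  1 ≤ i ∧ i ≤ len (ID p₀) ∧ bit (ID p₀) i = false

/-- What the analysis needs to know about the identifiers. -/
structure Setting (ID : Fin n → ℕ) (d : ℕ) (p₀ : Fin n) (e : ℕ → Fin n → ℕ) : Prop where
  d_pos : 1 ≤ d
  len_le : ∀ u, len (ID p₀) ≤ len (ID u)
  last : bit (ID p₀) (len (ID p₀)) = false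
  bit_eq_false : ∀ u i, 1 ≤ i → i ≤ len (ID p₀) → Agree ID p₀ i u → bit (ID u) i = false →
    bit (ID p₀) i = false
  agree_succ : ∀ u i, 1 ≤ i → i ≤ len (ID p₀) →
    (Agree ID p₀ (i + 1) u ↔ Agree ID p₀ i u ∧ bit (ID u) i = bit (ID p₀) i)
  agree_last : ∀ u, Agree ID p₀ (len (ID p₀)) u → u = p₀
  lag_lt : ∀ i u, Wave ID p₀ i → e i u < d
  lag_one : ∀ i u, Wave ID p₀ i → Agree ID p₀ i u → bit (ID u) i = true →
    e i (u - 1) + 1 ≤ e i u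
  lag_zero : ∀ i u, Wave ID p₀ i → ¬ Agree ID p₀ i u → e i (u - 1) ≤ e i u

omit [NeZero n] in
theorem agree_one (ID : Fin n → ℕ) (p₀ u : Fin n) : Agree ID p₀ 1 u := by
  simp [Agree, pref_zero]

theorem exists_setting {ID : Fin n → ℕ} {d : ℕ} {p₀ : Fin n} (hd : 1 ≤ d)
    (hz : ZeroEnded ID) (hf : StronglyPrefixFree ID) (hs : Scattered d ID)
    (hmin : ∀ q, ID p₀ ≤ ID q)
    (hpre : ∀ q, q ≠ p₀ → pref (len (ID p₀) - 1) (ID q) ≠ pref (len (ID p₀) - 1) (ID p₀)) :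
    ∃ e, Setting ID d p₀ e := by
  have hlen : ∀ u, len (ID p₀) ≤ len (ID u) := fun u => len_mono (hmin u)
  have hid : idMin ID = ID p₀ :=
    le_antisymm (ciInf_le (OrderBot.bddBelow _) p₀) (le_ciInf hmin)
  -- Strong prefix-freeness gives this at full length `len (ID p₀)`; truncating both sides gives all
  -- shorter prefixes.
  have hle : ∀ u i, i ≤ len (ID p₀) → pref i (ID p₀) ≤ pref i (ID u) := by
    intro u i hi
    rw [pref_eq_div hi le_rfl, pref_eq_div hi (hlen u), pref_len]
    exact Nat.div_le_div_right (hf _ _ (hmin u))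
  have hbit : ∀ u i, 1 ≤ i → i ≤ len (ID p₀) → Agree ID p₀ i u → bit (ID u) i = false →
      bit (ID p₀) i = false := by
    intro u i h1 h2 h3 h4
    have := hle u i h2
    rw [pref_eq_bit h1 h2, pref_eq_bit h1 (h2.trans (hlen u)), h3, h4] at this
    cases h : bit (ID p₀) i
    · rfl
    · simp [h] at this
  have hA : ∀ i, 1 ≤ i → i ≤ len (ID p₀) → ∀ u, u ∈ A ID i ↔ Agree ID p₀ i u := by
    intro i h1 h2 u
    refine ⟨fun h => le_antisymm (h p₀) (hle u _ (by omega)), fun h q => ?_⟩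
    rw [h]
    exact hle q _ (by omega)
  have hS : ∀ i, 1 ≤ i → i ≤ len (ID p₀) → p₀ ∈ A ID i := fun i h1 h2 => (hA i h1 h2 _).2 rfl
  have hT : ∀ i, Wave ID p₀ i → ∀ p ∈ A ID i, p ∉ A0 ID i →
      ∃ k, 1 ≤ k ∧ k < d ∧ (pred (A ID i))^[k] p ∈ A0 ID i := by
    rintro i ⟨h1, h2, h3⟩ p hp hp'
    -- In a wave round `p₀` itself lies in `A0 ID i`, which excludes the first alternative.
    rcases hs i h1 (by rwa [hid]) with h | h
    · have : p₀ ∈ A0 ID i := ⟨hS i h1 h2, h3⟩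
      rw [h] at this
      exact this.elim
    · refine (h p ⟨hp, ?_⟩).1
      by_contra hb
      exact hp' ⟨hp, by simpa using hb⟩
  refine ⟨fun i => lag (A ID i) (A0 ID i), hd, hlen, hz p₀, hbit, ?_, ?_, ?_, ?_, ?_⟩
  · intro u i h1 h2
    rw [Agree, Agree, Nat.add_sub_cancel, pref_eq_bit h1 h2, pref_eq_bit h1 (h2.trans (hlen u))]
    cases bit (ID u) i <;> cases bit (ID p₀) i <;> simp <;> omega
  · intro u hu
    by_contra h
    exact hpre u h hu
  · exact fun i u hw => lag_lt hd ⟨_, hS i hw.1 hw.2.1⟩ (hT i hw) u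
  · intro i u hw hu hb
    have hu' := (hA i hw.1 hw.2.1 u).2 hu
    have hn : u ∉ A0 ID i := fun h => by simp [h.2] at hb
    obtain ⟨k, -, -, hk⟩ := hT i hw u hu' hn
    exact lag_add_one_le ⟨_, hS i hw.1 hw.2.1⟩ hu' hn ⟨k, hk⟩
  · intro i u hw hu
    exact (lag_of_notMem ⟨_, hS i hw.1 hw.2.1⟩ fun h => hu ((hA i hw.1 hw.2.1 u).1 h)).le

end Analysis

section Analysis

variable {n : ℕ}

/-! ### Thresholds -/

theorem threshold_add {i : ℕ} (hi : 1 ≤ i) (d : ℕ) : (2 * i - 1) * d + d = 2 * i * d := by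
  rw [← Nat.succ_mul]; congr 1; omega

/-- The end of round `i` and the end of any later synchronization are at least `d` messages apart,
so the clockwise count tells rounds apart. -/
theorem threshold_lt {i j : ℕ} (h : i < j) (d : ℕ) : 2 * i * d + d ≤ (2 * j - 1) * d := by
  rw [← Nat.succ_mul]; exact Nat.mul_le_mul_right d (by omega)

theorem threshold_mono {i j : ℕ} (h : i ≤ j) (d : ℕ) : (2 * i - 1) * d ≤ (2 * j - 1) * d :=
  Nat.mul_le_mul_right d (by omega)

/-! ### The local invariant -/

section Local

variable (ID : Fin n → ℕ) (d : ℕ) (p₀ u : Fin n)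

/-- `u` is active in round `i`. -/
def Active (i : ℕ) : Prop := 1 ≤ i ∧ i ≤ len (ID p₀) ∧ Agree ID p₀ i u

/-- `u` becomes inactive in round `i`. -/
def Drops (i : ℕ) : Prop :=
  Active ID p₀ u i ∧ bit (ID u) i = true ∧ bit (ID p₀) i = false

/-- A process that has received `r` clockwise and `a` counter-clockwise messages has not received
many clockwise messages since the last counter-clockwise one. -/
def Recent (r a : ℕ) : Prop :=
  ∀ i, Wave ID p₀ i → zeros (ID p₀) i = a → r < 2 * i * d

/-- The local states that are possible at `u` after `r` clockwise messages have been received and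
`s` sent, and `a` counter-clockwise messages have been received and `b` sent. -/
def Possible (r s a b : ℕ) : LState → Prop
  | .syncSend i c => Active ID p₀ u i ∧ c < (2 * i - 1) * d ∧ r = c ∧ s = c ∧
      a = zeros (ID p₀) (i - 1) ∧ b = a
  | .syncReceive i c => Active ID p₀ u i ∧ c < (2 * i - 1) * d ∧ r = c ∧ s = c + 1 ∧
      a = zeros (ID p₀) (i - 1) ∧ b = a
  | .zeroSend i c => Active ID p₀ u i ∧ bit (ID u) i = false ∧ c = (2 * i - 1) * d ∧ r = c ∧ s = c ∧
      a = zeros (ID p₀) (i - 1) ∧ b = a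
  | .zeroReceive i c => Active ID p₀ u i ∧ bit (ID u) i = false ∧ c = (2 * i - 1) * d ∧ r = c ∧
      s = c ∧ a = zeros (ID p₀) (i - 1) ∧ b = a + 1
  | .termSend => u = p₀ ∧ r = (2 * len (ID p₀) - 1) * d ∧ s = r ∧
      a = zeros (ID p₀) (len (ID p₀)) ∧ b = a
  | .termReceive => u = p₀ ∧ r = (2 * len (ID p₀) - 1) * d ∧ s = r ∧
      a = zeros (ID p₀) (len (ID p₀)) ∧ b = a + 1
  | .checkSend i c => Active ID p₀ u i ∧ bit (ID u) i = true ∧ (2 * i - 1) * d ≤ c ∧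
      c < 2 * i * d ∧ r = c ∧ s = c ∧ a = zeros (ID p₀) (i - 1) ∧ b = a
  | .checkReceive i c => Active ID p₀ u i ∧ bit (ID u) i = true ∧ (2 * i - 1) * d ≤ c ∧
      c < 2 * i * d ∧ r = c ∧ s = c + 1 ∧ a = zeros (ID p₀) (i - 1) ∧ b = a
  | .forward => ∃ i, Drops ID p₀ u i ∧ (2 * i - 1) * d ≤ r ∧ r < 2 * i * d ∧ s = r + 1 ∧
      a = zeros (ID p₀) i ∧ a = b + 1
  | .relayReceive false k => k = 0 ∧ ∃ i, Drops ID p₀ u i ∧ (2 * i - 1) * d ≤ r ∧ r < 2 * i * d ∧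
      s = r + 1 ∧ a = zeros (ID p₀) i ∧ b = a
  | .relayReceive true k => (∃ i, Drops ID p₀ u i ∧ zeros (ID p₀) i ≤ a) ∧ s = r ∧ b = a ∧
      a ≤ zeros (ID p₀) (len (ID p₀)) ∧
      (k = 0 ∧ a < zeros (ID p₀) (len (ID p₀)) ∨ k = 1 ∧ Recent ID d p₀ r a)
  | .relaySend .one killed k => killed = true ∧ k = 0 ∧ (∃ i, Drops ID p₀ u i ∧ zeros (ID p₀) i ≤ a) ∧
      r = s + 1 ∧ b = a ∧ a < zeros (ID p₀) (len (ID p₀))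
  | .relaySend .zero killed k => killed = true ∧ (∃ i, Drops ID p₀ u i ∧ zeros (ID p₀) i < a) ∧
      s = r ∧ a = b + 1 ∧
      (k = 1 ∧ a ≤ zeros (ID p₀) (len (ID p₀)) ∧ Recent ID d p₀ r a ∨
        k = 2 ∧ a = zeros (ID p₀) (len (ID p₀)) + 1)
  | .returned .leader => u = p₀ ∧ s = r ∧ a = zeros (ID p₀) (len (ID p₀)) + 1 ∧ b = a
  | .returned .nonLeader => u ≠ p₀ ∧ s = r ∧ a = zeros (ID p₀) (len (ID p₀)) + 1 ∧ b = a
  | .returned .undecided => False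

variable [NeZero n] (e : ℕ → Fin n → ℕ)

/-- The local invariant. -/
structure Sound (st : LState) (r s a b : ℕ) : Prop where
  possible : Possible ID d p₀ u r s a b st
  lower : ∀ i, Wave ID p₀ i → zeros (ID p₀) i ≤ b → (2 * i - 1) * d ≤ r
  upper : ∀ i, Wave ID p₀ i → a < zeros (ID p₀) i → s ≤ (2 * i - 1) * d + e i u
  total : s ≤ (2 * len (ID p₀) - 1) * d

/-- What the neighbours of `u` guarantee: `R` is the number of clockwise messages sent to `u`, and
`B` the number of counter-clockwise ones. -/
structure Supply (r s a b R B : ℕ) : Prop where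
  cw_le : r ≤ R
  ccw_le : a ≤ B
  total : R ≤ (2 * len (ID p₀) - 1) * d
  lower : ∀ i, Wave ID p₀ i → zeros (ID p₀) i ≤ B → (2 * i - 1) * d ≤ s
  upper : ∀ i, Wave ID p₀ i → b < zeros (ID p₀) i → R ≤ (2 * i - 1) * d + e i (u - 1)

end Local

variable {ID : Fin n → ℕ} {d : ℕ} {p₀ : Fin n} {e : ℕ → Fin n → ℕ} {u : Fin n}

theorem Wave.zeros_eq {i : ℕ} (h : Wave ID p₀ i) :
    zeros (ID p₀) i = zeros (ID p₀) (i - 1) + 1 := zeros_of_false h.1 h.2.2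

theorem Wave.zeros_le {i : ℕ} (h : Wave ID p₀ i) :
    zeros (ID p₀) i ≤ zeros (ID p₀) (len (ID p₀)) := zeros_mono _ h.2.1

theorem Wave.zeros_lt {i j : ℕ} (h : Wave ID p₀ i) (hj : j < i) :
    zeros (ID p₀) j < zeros (ID p₀) i := ContentOblivious.zeros_lt hj h.2.2

theorem Drops.wave {i : ℕ} (h : Drops ID p₀ u i) : Wave ID p₀ i := ⟨h.1.1, h.1.2.1, h.2.2⟩

end Analysis

/-! ### Preservation of the local invariant by each instruction -/

section Analysis

variable {n : ℕ} {ID : Fin n → ℕ} {d : ℕ} {p₀ u : Fin n} {e : ℕ → Fin n → ℕ}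
variable {r s a b R B : ℕ} {st st' : LState}

theorem not_drops_self (i : ℕ) : ¬ Drops ID p₀ p₀ i := fun h => by
  have := h.2.1; rw [h.2.2] at this; cases this

theorem possible_send_zero (h : Possible ID d p₀ u r s a b st)
    (hi : logInstr (ID u) d st = .send .zero st') : Possible ID d p₀ u r (s + 1) a b st' := by
  cases st with
  | syncSend i c =>
    simp only [logInstr, Instr.send.injEq, true_and] at hi
    subst hi
    simp only [Possible] at h ⊢
    grind
  | checkSend i c =>
    simp only [logInstr, Instr.send.injEq, true_and] at hi
    subst hi
    simp only [Possible] at h ⊢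
    grind
  | relaySend q killed k =>
    cases q
    · simp [logInstr, Port.other] at hi
    · simp only [Possible] at h
      obtain ⟨rfl, rfl, h⟩ := h
      simp [logInstr, Port.other] at hi
      subst hi
      simp only [Possible]
      grind
  | _ => simp [logInstr] at hi

theorem possible_send_one (h : Possible ID d p₀ u r s a b st)
    (hi : logInstr (ID u) d st = .send .one st') : Possible ID d p₀ u r s a (b + 1) st' := by
  cases st with
  | zeroSend i c =>
    simp only [logInstr, Instr.send.injEq, true_and] at hi
    subst hi
    simp only [Possible] at h ⊢
    grind
  | termSend =>
    simp only [logInstr, Instr.send.injEq, true_and] at hi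
    subst hi
    simp only [Possible] at h ⊢
    grind
  | forward =>
    simp only [logInstr, Instr.send.injEq, true_and] at hi
    subst hi
    simp only [Possible] at h ⊢
    grind
  | relaySend q killed k =>
    cases q
    · simp only [Possible] at h
      obtain ⟨rfl, ⟨i, hd, hi'⟩, rfl, rfl, ⟨rfl, h1, h2⟩ | ⟨rfl, h1⟩⟩ := h
      · simp [logInstr, Port.other] at hi
        subst hi
        exact ⟨⟨i, hd, hi'.le⟩, rfl, rfl, h1, .inr ⟨rfl, h2⟩⟩
      · simp [logInstr, Port.other] at hi
        subst hi
        refine ⟨?_, rfl, h1, rfl⟩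
        rintro rfl
        exact not_drops_self i hd
    · simp [logInstr, Port.other] at hi
  | _ => simp [logInstr] at hi

namespace Setting

variable [NeZero n] (H : Setting ID d p₀ e)
include H

theorem wave_last : Wave ID p₀ (len (ID p₀)) := ⟨len_pos _, le_rfl, H.last⟩

theorem wave_of_active {i : ℕ} (h : Active ID p₀ u i) (hb : bit (ID u) i = false) :
    Wave ID p₀ i :=
  ⟨h.1, h.2.1, H.bit_eq_false u i h.1 h.2.1 h.2.2 hb⟩

/-- Only `p₀` is active in the last round, and its bit there is 0. Hence a dropout always has the
last wave and the termination wave still to relay, the two messages that its exit test needs. -/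
theorem lt_len_of_active {i : ℕ} (h : Active ID p₀ u i) (hb : bit (ID u) i = true) :
    i < len (ID p₀) := by
  refine lt_of_le_of_ne h.2.1 fun hi => ?_
  have := H.agree_last u (hi ▸ h.2.2)
  rw [this, hi, H.last] at hb
  cases hb

theorem active_succ {i : ℕ} (h : Active ID p₀ u i) (hi : i < len (ID p₀))
    (hb : bit (ID u) i = bit (ID p₀) i) : Active ID p₀ u (i + 1) :=
  ⟨by omega, hi, (H.agree_succ u i h.1 h.2.1).2 ⟨h.2.2, hb⟩⟩

theorem enterRound_eq {i c : ℕ} (h : i ≤ len (ID p₀)) :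
    enterRound (ID u) i c = .syncSend i c := by
  rw [enterRound, if_pos (h.trans (H.len_le u))]

theorem agree_of_le {i j : ℕ} (hj : j ≤ len (ID p₀)) (hi : 1 ≤ i) (hij : i ≤ j)
    (h : Agree ID p₀ j u) : Agree ID p₀ i u := by
  induction j, hij using Nat.le_induction with
  | base => exact h
  | succ j hij ih => exact ih (by omega) (((H.agree_succ u j (by omega) (by omega)).1 h).1)

theorem not_agree_of_drops {i j : ℕ} (h : Drops ID p₀ u i) (hij : i < j) (hj : j ≤ len (ID p₀)) :
    ¬ Agree ID p₀ j u := fun hu => by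
  have := H.agree_of_le hj (by omega) (Nat.succ_le_of_lt hij) hu
  have := ((H.agree_succ u i h.1.1 h.1.2.1).1 this).2
  rw [h.2.1, h.2.2] at this
  cases this

/-- A counter-clockwise message has been received before it was sent on, except by the processes
that initiate a wave of counter-clockwise messages. -/
theorem received_of_sent (h : Possible ID d p₀ u r s a b st) {i : ℕ} (hi : Wave ID p₀ i)
    (hn : ¬ (Agree ID p₀ i u ∧ bit (ID u) i = false)) (hb : zeros (ID p₀) i ≤ b) :
    zeros (ID p₀) i ≤ a := by
  have hz := hi.zeros_le
  cases st with
  | zeroReceive j c =>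
    obtain ⟨h1, h2, -, -, -, h3, h4⟩ := h
    have hw := H.wave_of_active h1 h2
    have := hw.zeros_eq
    rcases lt_trichotomy i j with hij | rfl | hij
    · have := hw.zeros_lt hij; omega
    · exact absurd ⟨h1.2.2, h2⟩ hn
    · have := hi.zeros_lt hij; omega
  | relayReceive killed k => cases killed <;> simp only [Possible] at h <;> grind
  | relaySend q killed k => cases q <;> simp only [Possible] at h <;> grind
  | returned v => cases v <;> simp only [Possible] at h <;> grind
  | _ => simp only [Possible] at h; grind

/-- Two transitions need an argument. A process with bit 1 completes No-Zero Checking only if `p₀`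
has bit 1 too, because the lag is below `d`. A relay gets no clockwise message after the last wave,
because the total budget is spent. -/
theorem possible_receive_one (h : Sound ID d p₀ u e st r s a b)
    (hs : Supply ID d p₀ u e r s a b R B) (hR : r < R)
    (hi : logInstr (ID u) d st = .receive .one st' ∨
      ∃ f, logInstr (ID u) d st = .receiveAny f ∧ f .one = st') :
    Possible ID d p₀ u (r + 1) s a b st' := by
  have hp := h.possible
  cases st with
  | syncReceive i c =>
    simp only [logInstr, Instr.receive.injEq, true_and, reduceCtorEq, false_and, exists_false,
      or_false] at hi
    obtain ⟨h1, h2, rfl, rfl, h3, h4⟩ := hp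
    have := threshold_add h1.1 d
    have := H.d_pos
    subst hi
    split_ifs with hc hb
    · exact ⟨h1, hb, hc, rfl, rfl, h3, h4⟩
    · exact ⟨h1, by simpa using hb, by omega, by omega, rfl, rfl, h3, h4⟩
    · exact ⟨h1, by omega, rfl, rfl, h3, h4⟩
  | checkReceive i c =>
    simp only [logInstr, Instr.receiveAny.injEq, reduceCtorEq, false_or] at hi
    obtain ⟨f, rfl, rfl⟩ := hi
    obtain ⟨h1, hb, h2, h2', rfl, rfl, h3, h4⟩ := hp
    dsimp only
    have hi := H.lt_len_of_active h1 hb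
    split_ifs with hc
    · have hw : bit (ID p₀) i = true := by
        by_contra hw
        have hw : Wave ID p₀ i := ⟨h1.1, h1.2.1, by simpa using hw⟩
        have := hw.zeros_eq
        have := h.upper i hw (by omega)
        have := threshold_add h1.1 d
        have := H.lag_lt i u hw
        omega
      rw [H.enterRound_eq (i := i + 1) hi]
      refine ⟨H.active_succ h1 hi (by rw [hb, hw]), ?_, rfl, rfl, ?_, h4⟩
      · have := threshold_lt (Nat.lt_add_one i) d
        have := H.d_pos
        omega
      · rw [h3, Nat.add_sub_cancel, zeros_of_true h1.1 hw]
    · exact ⟨h1, hb, by omega, by omega, rfl, rfl, h3, h4⟩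
  | relayReceive killed k =>
    simp only [logInstr, Instr.receiveAny.injEq, reduceCtorEq, false_or] at hi
    obtain ⟨f, rfl, rfl⟩ := hi
    cases killed
    · obtain ⟨rfl, i, h1, h2, h3, h4, h5, h6⟩ := hp
      have := H.wave_last.zeros_lt (H.lt_len_of_active h1.1 h1.2.1)
      exact ⟨⟨i, h1, by omega⟩, h4, h6, by omega, .inl ⟨rfl, by omega⟩⟩
    · obtain ⟨h1, h2, h3, h4, h5⟩ := hp
      refine ⟨rfl, rfl, h1, by omega, h3, lt_of_le_of_ne h4 fun ha => ?_⟩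
      have := h.lower _ H.wave_last (by omega)
      have := hs.total
      omega
  | _ => simp [logInstr] at hi

/-- An incoming message of wave `j` certifies, through `Supply.lower`, that `u` has sent at least
`(2j-1)d` clockwise messages. Comparing this with the count of `u` shows to which wave the message
can belong. -/
theorem possible_receive_zero (h : Sound ID d p₀ u e st r s a b)
    (hs : Supply ID d p₀ u e r s a b R B) (hB : a < B)
    (hi : logInstr (ID u) d st = .receive .zero st' ∨
      ∃ f, logInstr (ID u) d st = .receiveAny f ∧ f .zero = st') :
    Possible ID d p₀ u r s (a + 1) b st' := by
  have hp := h.possible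
  cases st with
  | zeroReceive i c =>
    simp only [logInstr, Instr.receive.injEq, true_and, reduceCtorEq, false_and, exists_false,
      or_false] at hi
    obtain ⟨h1, hb, h2, rfl, rfl, h3, h4⟩ := hp
    have hw := H.wave_of_active h1 hb
    have hz := hw.zeros_eq
    have hb' : bit (ID u) i = bit (ID p₀) i := by rw [hb, hw.2.2]
    subst hi
    rcases h1.2.1.eq_or_lt with hl | hl
    · have hu : u = p₀ := H.agree_last u (hl ▸ h1.2.2)
      subst hu
      rw [if_pos hl]
      exact ⟨rfl, by rw [h2, hl], rfl, by rw [← hl]; omega, h4⟩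
    · rw [if_neg (by have := H.len_le u; omega), H.enterRound_eq (i := i + 1) hl]
      refine ⟨H.active_succ h1 hl hb', ?_, rfl, rfl, ?_, h4⟩
      · have := threshold_lt (Nat.lt_add_one i) d
        have := threshold_add h1.1 d
        have := H.d_pos
        omega
      · rw [Nat.add_sub_cancel]; omega
  | termReceive =>
    simp only [logInstr, Instr.receive.injEq, true_and, reduceCtorEq, false_and, exists_false,
      or_false] at hi
    obtain ⟨h1, h2, h3, h4, h5⟩ := hp
    subst hi
    exact ⟨h1, h3, by omega, h5⟩
  | checkReceive i c =>
    simp only [logInstr, Instr.receiveAny.injEq, reduceCtorEq, false_or] at hi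
    obtain ⟨f, rfl, rfl⟩ := hi
    obtain ⟨h1, hb, h2, h2', rfl, rfl, h3, h4⟩ := hp
    have hi := H.lt_len_of_active h1 hb
    have hz := H.wave_last.zeros_lt (j := i - 1) (by omega)
    obtain ⟨j, hj1, hj2, hj3, hj4⟩ := exists_zeros_eq (x := ID p₀) (j := zeros (ID p₀) (i - 1) + 1)
      (by omega) (Nat.succ_le_of_lt hz)
    have hj : i - 1 < j := lt_of_zeros_lt (x := ID p₀) (by omega)
    have hlow := hs.lower j ⟨hj1, hj2, hj3⟩ (by omega)
    -- A later wave would need more than the at most `2id` clockwise messages sent so far, so the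
    -- dropout happens in a round where `p₀` has bit 0.
    have hij : j = i := by
      by_contra hij
      have := threshold_lt (show i < j by omega) d
      have := H.d_pos
      omega
    subst hij
    exact ⟨j, ⟨h1, hb, hj3⟩, h2, h2', rfl, by omega, by omega⟩
  | relayReceive killed k =>
    simp only [logInstr, Instr.receiveAny.injEq, reduceCtorEq, false_or] at hi
    obtain ⟨f, rfl, rfl⟩ := hi
    cases killed
    · obtain ⟨rfl, i, h1, h2, h3, h4, h5, h6⟩ := hp
      -- The surplus clockwise message must be killed before another wave can arrive: until then `s
      -- = r + 1 ≤ 2id`, too few for a later wave.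
      exfalso
      have hz := H.wave_last.zeros_lt (H.lt_len_of_active h1.1 h1.2.1)
      obtain ⟨j, hj1, hj2, hj3, hj4⟩ := exists_zeros_eq (x := ID p₀) (j := zeros (ID p₀) i + 1)
        (by omega) (Nat.succ_le_of_lt hz)
      have hj : i < j := lt_of_zeros_lt (x := ID p₀) (by omega)
      have := hs.lower j ⟨hj1, hj2, hj3⟩ (by omega)
      have := threshold_lt hj d
      have := H.d_pos
      omega
    · obtain ⟨⟨i, h1, h1'⟩, h2, h3, h4, h5⟩ := hp
      refine ⟨rfl, ⟨i, h1, by omega⟩, h2, by omega, ?_⟩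
      rcases h4.lt_or_eq with ha | ha
      · left
        obtain ⟨j, hj1, hj2, hj3, hj4⟩ := exists_zeros_eq (x := ID p₀) (j := a + 1)
          (by omega) (Nat.succ_le_of_lt ha)
        -- If `k = 1`, then `Recent` says that fewer than `2ld` clockwise messages came in since the
        -- start, `l` being the previous wave. Wave `j > l` requires at least `(2j-1)d`.
        have hk : k = 0 := by
          rcases h5 with h5 | ⟨-, h5⟩
          · exact h5.1
          · exfalso
            have := h1.wave.zeros_eq
            obtain ⟨l, hl1, hl2, hl3, hl4⟩ := exists_zeros_eq (x := ID p₀) (j := a) (by omega) h4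
            have hl : l < j := lt_of_zeros_lt (x := ID p₀) (by omega)
            have := h5 l ⟨hl1, hl2, hl3⟩ hl4
            have := hs.lower j ⟨hj1, hj2, hj3⟩ (by omega)
            have := threshold_lt hl d
            omega
        refine ⟨by omega, ha, fun l hl hl' => ?_⟩
        have := h.upper l hl (by omega)
        have := H.lag_lt l u hl
        have := threshold_add hl.1 d
        omega
      · right
        omega
  | _ => simp [logInstr] at hi

/-- The bound `upper` is inherited from the counter-clockwise neighbour: an active process with bit
1 gains one message and `lag_one` grants it one, while a relay gains nothing and `lag_zero`
suffices. -/
theorem sound_send_zero (h : Sound ID d p₀ u e st r s a b)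
    (hs : Supply ID d p₀ u e r s a b R B)
    (hi : logInstr (ID u) d st = .send .zero st') : Sound ID d p₀ u e st' r (s + 1) a b := by
  have hp := h.possible
  refine ⟨possible_send_zero hp hi, h.lower, ?_, ?_⟩
  · intro i hw ha
    cases st with
    | syncSend j c =>
      obtain ⟨h1, h2, rfl, rfl, h3, h4⟩ := hp
      have hj : j - 1 < i := lt_of_zeros_lt (x := ID p₀) (by omega)
      have := threshold_mono (show j ≤ i by omega) d
      omega
    | checkSend j c =>
      obtain ⟨h1, hb, h2, h2', rfl, rfl, h3, h4⟩ := hp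
      have hj : j - 1 < i := lt_of_zeros_lt (x := ID p₀) (by omega)
      rcases (show j ≤ i by omega).eq_or_lt with rfl | hj'
      · have := hs.upper j hw (by omega)
        have := H.lag_one j u hw h1.2.2 hb
        have := hs.cw_le
        omega
      · have := threshold_lt hj' d
        omega
    | relaySend q killed k =>
      cases q
      · simp [logInstr, Port.other] at hi
      · obtain ⟨-, -, ⟨j, h1, h1'⟩, h2, h3, h4⟩ := hp
        have hj : j < i := lt_of_zeros_lt (x := ID p₀) (by omega)
        have := hs.upper i hw (by omega)
        have := H.lag_zero i u hw (H.not_agree_of_drops h1 hj hw.2.1)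
        have := hs.cw_le
        omega
    | _ => simp [logInstr] at hi
  · cases st with
    | syncSend j c =>
      obtain ⟨h1, h2, rfl, rfl, h3, h4⟩ := hp
      have := threshold_mono h1.2.1 d
      omega
    | checkSend j c =>
      obtain ⟨h1, hb, h2, h2', rfl, rfl, h3, h4⟩ := hp
      have := threshold_lt (H.lt_len_of_active h1 hb) d
      omega
    | relaySend q killed k =>
      cases q
      · simp [logInstr, Port.other] at hi
      · obtain ⟨-, -, -, h2, h3, h4⟩ := hp
        have := hs.cw_le
        have := hs.total
        omega
    | _ => simp [logInstr] at hi

/-- Processes signalling 0, dropouts and the terminating `p₀` meet `lower` by their own thresholds.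
A relay meets it because its clockwise neighbour, which already sent this wave, got its clockwise
messages from `u`, and here `s = r`. -/
theorem sound_send_one (h : Sound ID d p₀ u e st r s a b)
    (hs : Supply ID d p₀ u e r s a b R B)
    (hi : logInstr (ID u) d st = .send .one st') : Sound ID d p₀ u e st' r s a (b + 1) := by
  have hp := h.possible
  refine ⟨possible_send_one hp hi, ?_, h.upper, h.total⟩
  intro i hw hb
  cases st with
  | zeroSend j c =>
    obtain ⟨h1, h2, h3, rfl, rfl, h4, h5⟩ := hp
    have hj : i - 1 < j := by
      have := hw.zeros_eq
      have := (H.wave_of_active h1 h2).zeros_eq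
      exact lt_of_zeros_lt (x := ID p₀) (by omega)
    have := threshold_mono (show i ≤ j by omega) d
    omega
  | termSend =>
    obtain ⟨-, h1, -⟩ := hp
    have := threshold_mono hw.2.1 d
    omega
  | forward =>
    obtain ⟨j, h1, h2, h3, h4, h5, h6⟩ := hp
    have hj : i - 1 < j := by
      have := hw.zeros_eq
      exact lt_of_zeros_lt (x := ID p₀) (by omega)
    have := threshold_mono (show i ≤ j by omega) d
    omega
  | relaySend q killed k =>
    cases q
    · obtain ⟨-, -, h1, h2, -⟩ := hp
      have := hs.ccw_le
      have := hs.lower i hw (by omega)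
      omega
    · simp [logInstr, Port.other] at hi
  | _ => simp [logInstr] at hi

theorem sound_receive_one (h : Sound ID d p₀ u e st r s a b)
    (hs : Supply ID d p₀ u e r s a b R B) (hR : r < R)
    (hi : logInstr (ID u) d st = .receive .one st' ∨
      ∃ f, logInstr (ID u) d st = .receiveAny f ∧ f .one = st') :
    Sound ID d p₀ u e st' (r + 1) s a b :=
  ⟨H.possible_receive_one h hs hR hi, fun i hw hb => (h.lower i hw hb).trans (Nat.le_succ _),
    h.upper, h.total⟩

theorem sound_receive_zero (h : Sound ID d p₀ u e st r s a b)
    (hs : Supply ID d p₀ u e r s a b R B) (hB : a < B)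
    (hi : logInstr (ID u) d st = .receive .zero st' ∨
      ∃ f, logInstr (ID u) d st = .receiveAny f ∧ f .zero = st') :
    Sound ID d p₀ u e st' r s (a + 1) b :=
  ⟨H.possible_receive_zero h hs hB hi, h.lower, fun i hw ha => h.upper i hw (by omega), h.total⟩

end Setting
end Analysis

section Analysis

variable {n : ℕ} [NeZero n]

/-! ### The global invariant -/

/-- The invariant of the execution: `r u` and `a u` are the numbers of clockwise and of
counter-clockwise messages that `u` has received. -/
structure Invariant (ID : Fin n → ℕ) (d : ℕ) (p₀ : Fin n) (e : ℕ → Fin n → ℕ)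
    (c : Config n LState) (r a : Fin n → ℕ) : Prop where
  sound : ∀ u, Sound ID d p₀ u e (c.state u) (r u) (c.cwSent u) (a u) (c.ccwSent u)
  cw : ∀ u, c.cw (u - 1) + r u = c.cwSent (u - 1)
  ccw : ∀ u, c.ccw (u + 1) + a u = c.ccwSent (u + 1)

/-- The programs of the processes. -/
abbrev programs (ID : Fin n → ℕ) (d : ℕ) : Fin n → Program LState :=
  fun p => logarithmicLeaderElection (ID p) d

variable {ID : Fin n → ℕ} {d : ℕ} {p₀ : Fin n} {e : ℕ → Fin n → ℕ}
variable {c c' : Config n LState} {r a : Fin n → ℕ}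

namespace Invariant

theorem cw_sub (h : Invariant ID d p₀ e c r a) (u : Fin n) :
    c.cw u + r (u + 1) = c.cwSent u := by
  simpa using h.cw (u + 1)

theorem ccw_add (h : Invariant ID d p₀ e c r a) (u : Fin n) :
    c.ccw u + a (u - 1) = c.ccwSent u := by
  simpa using h.ccw (u - 1)

theorem supply (h : Invariant ID d p₀ e c r a) (u : Fin n) :
    Supply ID d p₀ u e (r u) (c.cwSent u) (a u) (c.ccwSent u)
      (c.cwSent (u - 1)) (c.ccwSent (u + 1)) where
  cw_le := (Nat.le_add_left _ _).trans_eq (h.cw u)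
  ccw_le := (Nat.le_add_left _ _).trans_eq (h.ccw u)
  total := (h.sound _).total
  lower i hw hi :=
    ((h.sound _).lower i hw hi).trans ((Nat.le_add_left _ _).trans_eq (h.cw_sub u))
  upper i hw hi := (h.sound _).upper i hw <|
    lt_of_le_of_lt ((Nat.le_add_left _ _).trans_eq (h.ccw_add u)) hi

theorem send (H : Setting ID d p₀ e) (h : Invariant ID d p₀ e c r a) {p : Fin n} {q : Port}
    {st : LState} (hi : logInstr (ID p) d (c.state p) = .send q st) :
    Invariant ID d p₀ e (c.send p st q) r a := by
  cases q
  · have key := H.sound_send_zero (h.sound p) (h.supply p) hi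
    refine ⟨fun u => ?_, fun u => ?_, h.ccw⟩
    · rcases eq_or_ne u p with rfl | hu
      · simpa [Config.send] using key
      · simpa [Config.send, hu] using h.sound u
    · have := h.cw u
      rcases eq_or_ne (u - 1) p with hu | hu
      · rw [hu] at this
        simp only [Config.send, hu, Function.update_self]
        omega
      · simpa [Config.send, hu] using this
  · have key := H.sound_send_one (h.sound p) (h.supply p) hi
    refine ⟨fun u => ?_, h.cw, fun u => ?_⟩
    · rcases eq_or_ne u p with rfl | hu
      · simpa [Config.send] using key
      · simpa [Config.send, hu] using h.sound u
    · have := h.ccw u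
      rcases eq_or_ne (u + 1) p with hu | hu
      · rw [hu] at this
        simp only [Config.send, hu, Function.update_self]
        omega
      · simpa [Config.send, hu] using this

theorem receive (H : Setting ID d p₀ e) (h : Invariant ID d p₀ e c r a) {p : Fin n} {q : Port}
    {st : LState} (hq : 0 < c.inbox p q)
    (hi : logInstr (ID p) d (c.state p) = .receive q st ∨
      ∃ f, logInstr (ID p) d (c.state p) = .receiveAny f ∧ f q = st) :
    ∃ r' a', Invariant ID d p₀ e (c.receive p st q) r' a' := by
  cases q
  · simp only [Config.inbox] at hq
    have hp := h.ccw p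
    have key := H.sound_receive_zero (h.sound p) (h.supply p) (by omega) hi
    refine ⟨r, Function.update a p (a p + 1), fun u => ?_, h.cw, fun u => ?_⟩
    · rcases eq_or_ne u p with rfl | hu
      · simpa [Config.receive] using key
      · simpa [Config.receive, hu] using h.sound u
    · rcases eq_or_ne u p with rfl | hu
      · simp only [Config.receive, Function.update_self]
        omega
      · simpa [Config.receive, hu] using h.ccw u
  · simp only [Config.inbox] at hq
    have hp := h.cw p
    have key := H.sound_receive_one (h.sound p) (h.supply p) (by omega) hi
    refine ⟨Function.update r p (r p + 1), a, fun u => ?_, fun u => ?_, h.ccw⟩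
    · rcases eq_or_ne u p with rfl | hu
      · simpa [Config.receive] using key
      · simpa [Config.receive, hu] using h.sound u
    · rcases eq_or_ne u p with rfl | hu
      · simp only [Config.receive, Function.update_self]
        omega
      · simpa [Config.receive, hu] using h.cw u

theorem step (H : Setting ID d p₀ e) (h : Invariant ID d p₀ e c r a)
    (hc : Step (programs ID d) c c') : ∃ r' a', Invariant ID d p₀ e c' r' a' := by
  cases hc with
  | send p q s hi => exact ⟨r, a, h.send H hi⟩
  | receive p q s hi hq => exact h.receive H hq (.inl hi)
  | receiveAny p q f hi hq => exact h.receive H hq (.inr ⟨f, hi, rfl⟩)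

end Invariant

theorem Reachable.invariant (H : Setting ID d p₀ e) (hc : Reachable (programs ID d) c) :
    ∃ r a, Invariant ID d p₀ e c r a := by
  induction hc with
  | refl =>
    refine ⟨0, 0, fun u => ⟨?_, ?_, ?_, ?_⟩, fun u => rfl, fun u => rfl⟩
    · have h0 : 0 < d := H.d_pos
      have h1 : Active ID p₀ u 1 := ⟨le_rfl, len_pos _, agree_one ID p₀ u⟩
      simpa [initial, programs, logarithmicLeaderElection, H.enterRound_eq (u := u) (len_pos _),
        Possible, zeros, h1] using h0
    · intro i hw hi
      have := hw.zeros_eq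
      simp only [initial] at hi
      omega
    · exact fun _ _ _ => Nat.zero_le _
    · exact Nat.zero_le _
  | tail _ hs ih =>
    obtain ⟨r, a, h⟩ := ih
    exact h.step H hs

/-! ### Termination -/

theorem Sound.ccwSent_le {u : Fin n} {st : LState} {r s a b : ℕ}
    (h : Sound ID d p₀ u e st r s a b) (H : Setting ID d p₀ e) :
    b ≤ zeros (ID p₀) (len (ID p₀)) + 1 := by
  have hp := h.possible
  have hz : ∀ i, Active ID p₀ u i → zeros (ID p₀) (i - 1) < zeros (ID p₀) (len (ID p₀)) :=
    fun i hi => H.wave_last.zeros_lt (by have := hi.1; have := hi.2.1; omega)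
  have hz' : ∀ i, Drops ID p₀ u i → zeros (ID p₀) i ≤ zeros (ID p₀) (len (ID p₀)) :=
    fun i hi => hi.wave.zeros_le
  cases st with
  | relayReceive killed k => cases killed <;> simp only [Possible] at hp <;> grind
  | relaySend q killed k => cases q <;> simp only [Possible] at hp <;> grind
  | returned v => cases v <;> simp only [Possible] at hp <;> grind
  | _ => simp only [Possible] at hp; grind

/-- A quantity that decreases in each step, where no process sends more than `S` clockwise and `B`
counter-clockwise messages. -/
def potential (S B : ℕ) (c : Config n LState) : ℕ :=
  ∑ u, (2 * (S - c.cwSent u) + c.cw u + (2 * (B - c.ccwSent u) + c.ccw u))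

/-- An unsent message weighs 2, a message in transit 1 and a received one 0. The bounds are required
after the step, so that truncated subtraction does decrease on a send. -/
theorem potential_lt {S B : ℕ} {P : Fin n → Program LState} (hc : Step P c c')
    (hS : ∀ u, c'.cwSent u ≤ S) (hB : ∀ u, c'.ccwSent u ≤ B) :
    potential S B c' < potential S B c := by
  have key : ∀ p q st, (∀ u, (c.send p st q).cwSent u ≤ S) →
      (∀ u, (c.send p st q).ccwSent u ≤ B) →
      potential S B (c.send p st q) < potential S B c := by
    intro p q st hS hB
    have hS := hS p
    have hB := hB p
    refine Finset.sum_lt_sum (fun u _ => ?_) ⟨p, Finset.mem_univ _, ?_⟩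
    · rcases eq_or_ne u p with rfl | hu
      · cases q <;> simp only [Config.send, Function.update_self] at hS hB ⊢ <;> omega
      · cases q <;> simp [Config.send, hu]
    · cases q <;> simp only [Config.send, Function.update_self] at hS hB ⊢ <;> omega
  have key' : ∀ p q st, 0 < c.inbox p q → potential S B (c.receive p st q) < potential S B c := by
    intro p q st hq
    cases q <;> simp only [Config.inbox] at hq
    · refine Finset.sum_lt_sum (fun u _ => ?_) ⟨p + 1, Finset.mem_univ _, ?_⟩
      · rcases eq_or_ne u (p + 1) with rfl | hu
        · simp only [Config.receive, Function.update_self]; omega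
        · simp [Config.receive, hu]
      · simp only [Config.receive, Function.update_self]; omega
    · refine Finset.sum_lt_sum (fun u _ => ?_) ⟨p - 1, Finset.mem_univ _, ?_⟩
      · rcases eq_or_ne u (p - 1) with rfl | hu
        · simp only [Config.receive, Function.update_self]; omega
        · simp [Config.receive, hu]
      · simp only [Config.receive, Function.update_self]; omega
  cases hc with
  | send p q s hi => exact key p q s hS hB
  | receive p q s hi hq => exact key' p q s hq
  | receiveAny p q f hi hq => exact key' p q _ hq

theorem Setting.finite (H : Setting ID d p₀ e) :
    ¬ ∃ x : ℕ → Config n LState, x 0 = initial (programs ID d) ∧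
      ∀ t, Step (programs ID d) (x t) (x (t + 1)) := by
  rintro ⟨x, h0, hx⟩
  have hr : ∀ t, Reachable (programs ID d) (x t) := by
    intro t
    induction t with
    | zero => rw [h0]; exact .refl
    | succ t ih => exact ih.tail (hx t)
  obtain ⟨t, ht⟩ := WellFounded.has_min (measure fun t => potential ((2 * len (ID p₀) - 1) * d)
    (zeros (ID p₀) (len (ID p₀)) + 1) (x t)).wf Set.univ ⟨0, trivial⟩
  obtain ⟨r, a, h⟩ := (hr (t + 1)).invariant H
  exact ht.2 (t + 1) trivial (potential_lt (hx t) (fun u => (h.sound u).total)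
    fun u => (h.sound u).ccwSent_le H)

/-! ### The final configuration -/

theorem Sound.received_of_sent {u : Fin n} {st : LState} {r s a b : ℕ}
    (h : Sound ID d p₀ u e st r s a b) (H : Setting ID d p₀ e) (hu : u ≠ p₀)
    (hb : zeros (ID p₀) (len (ID p₀)) < b) : zeros (ID p₀) (len (ID p₀)) < a := by
  have hp := h.possible
  cases st with
  | zeroReceive i c =>
    obtain ⟨h1, h2, -, -, -, h3, h4⟩ := hp
    have hw := H.wave_of_active h1 h2
    have := hw.zeros_eq
    have := hw.zeros_le
    omega
  | relayReceive killed k => cases killed <;> simp only [Possible] at hp <;> grind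
  | relaySend q killed k => cases q <;> simp only [Possible] at hp <;> grind
  | returned v => cases v <;> simp only [Possible] at hp <;> grind
  | _ => simp only [Possible] at hp; grind

theorem Sound.eq_returned {u : Fin n} {st : LState} {r s a b : ℕ}
    (h : Sound ID d p₀ u e st r s a b) (H : Setting ID d p₀ e)
    (ha : zeros (ID p₀) (len (ID p₀)) < a) (hb : zeros (ID p₀) (len (ID p₀)) < b) :
    (u = p₀ ∧ st = .returned .leader ∨ u ≠ p₀ ∧ st = .returned .nonLeader) ∧
      a = zeros (ID p₀) (len (ID p₀)) + 1 ∧ b = a ∧ s = r := by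
  have hp := h.possible
  have hz : ∀ i, Active ID p₀ u i → zeros (ID p₀) (i - 1) < zeros (ID p₀) (len (ID p₀)) :=
    fun i hi => H.wave_last.zeros_lt (by have := hi.1; have := hi.2.1; omega)
  have hz' : ∀ i, Drops ID p₀ u i → zeros (ID p₀) i ≤ zeros (ID p₀) (len (ID p₀)) :=
    fun i hi => hi.wave.zeros_le
  cases st with
  | relayReceive killed k => cases killed <;> simp only [Possible] at hp <;> grind
  | relaySend q killed k => cases q <;> simp only [Possible] at hp <;> grind
  | returned v => cases v <;> simp only [Possible] at hp <;> grind
  | _ => simp only [Possible] at hp; grind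

namespace Invariant

variable (h : Invariant ID d p₀ e c r a) (H : Setting ID d p₀ e)
include h H

/-- The wave of termination goes around the ring. -/
theorem terminated_of_received {v : Fin n} (hv : zeros (ID p₀) (len (ID p₀)) < a v)
    (hp : zeros (ID p₀) (len (ID p₀)) < c.ccwSent p₀ →
      zeros (ID p₀) (len (ID p₀)) < a p₀) (u : Fin n) :
    zeros (ID p₀) (len (ID p₀)) < a u := by
  refine forall_of_forall_add_one (P := fun u => zeros (ID p₀) (len (ID p₀)) < a u) hv
    (fun u hu => ?_) u
  have hb : zeros (ID p₀) (len (ID p₀)) < c.ccwSent (u + 1) := hu.trans_le (h.supply u).ccw_le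
  rcases eq_or_ne (u + 1) p₀ with he | he
  · rw [he] at hb ⊢
    exact hp hb
  · exact (h.sound _).received_of_sent H he hb

theorem final (hp : zeros (ID p₀) (len (ID p₀)) < a p₀) :
    Returned (programs ID d) c p₀ .leader ∧
      (∀ p, p ≠ p₀ → Returned (programs ID d) c p .nonLeader) ∧ c.Quiet ∧
      ∀ p, c.cwSent p = (2 * len (ID p₀) - 1) * d := by
  -- Each process other than `p₀` sends the termination message only after receiving it, so its
  -- arrival at `p₀` implies that all have received it.
  have ha := h.terminated_of_received H hp fun _ => hp
  have hb : ∀ u, zeros (ID p₀) (len (ID p₀)) < c.ccwSent u := fun u =>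
    (ha (u - 1)).trans_le ((Nat.le_add_left _ _).trans_eq (h.ccw_add u))
  have hr := fun u => (h.sound u).eq_returned H (ha u) (hb u)
  have hs : ∀ u, r u = (2 * len (ID p₀) - 1) * d ∧ c.cwSent u = (2 * len (ID p₀) - 1) * d := by
    intro u
    have := (hr u).2.2.2
    have := (h.sound u).lower _ H.wave_last (hb u).le
    have := (h.sound u).total
    omega
  refine ⟨?_, fun p hp => ?_, fun p => ⟨?_, ?_⟩, fun p => (hs p).2⟩
  · have : c.state p₀ = .returned .leader := by simpa using (hr p₀).1
    simp [Returned, programs, logarithmicLeaderElection, this, logInstr]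
  · have : c.state p = .returned .nonLeader := by simpa [hp] using (hr p).1
    simp [Returned, programs, logarithmicLeaderElection, this, logInstr]
  · have := h.cw_sub p
    have := (hs (p + 1)).1
    have := (hs p).2
    omega
  · have := h.ccw_add p
    have := (hr (p - 1)).2.1
    have := (hr p).2
    omega

end Invariant

end Analysis

section Analysis

variable {n : ℕ} [NeZero n]
variable {ID : Fin n → ℕ} {d : ℕ} {p₀ : Fin n} {e : ℕ → Fin n → ℕ}
variable {c : Config n LState} {r a : Fin n → ℕ}

/-! ### Absence of deadlocks -/

/-- What is known about the process `u` when no step is possible; the counters are as in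
`Supply`. -/
inductive Blocked (ID : Fin n → ℕ) (d : ℕ) (p₀ u : Fin n) (s a b R B : ℕ) : Prop
  | active (i : ℕ) (hi : Active ID p₀ u i) (hs : s = R + 1) (hd : s ≤ 2 * i * d)
      (ha : a = zeros (ID p₀) (i - 1)) (hb : b = a) (h : s ≤ (2 * i - 1) * d ∨ B = a)
  | wave (i : ℕ) (hi : Wave ID p₀ i) (hs : s = (2 * i - 1) * d)
      (ha : a + 1 = zeros (ID p₀) i) (hb : b = a + 1) (hB : B = a)
  | relay (hu : u ≠ p₀) (hs : R ≤ s) (hb : b = a) (hB : B = a)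
  | term (hu : u = p₀) (ha : a = zeros (ID p₀) (len (ID p₀))) (hb : b = a + 1) (hB : B = a)
  | returned (ha : zeros (ID p₀) (len (ID p₀)) < a) (hb : b = a)

/-- No process is about to send, and every port listened to is empty. An empty port turns the
inequality between messages sent to `u` and received by `u` into an equality. -/
theorem Stuck.blocked (hc : Stuck (programs ID d) c) (h : Invariant ID d p₀ e c r a)
    (H : Setting ID d p₀ e) (u : Fin n) :
    Blocked ID d p₀ u (c.cwSent u) (a u) (c.ccwSent u) (c.cwSent (u - 1)) (c.ccwSent (u + 1)) := by
  have hsend : ∀ q st, logInstr (ID u) d (c.state u) ≠ .send q st :=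
    fun q st hi => hc _ (.send u q st hi)
  have hrec : ∀ q st, logInstr (ID u) d (c.state u) = .receive q st → c.inbox u q = 0 :=
    fun q st hi => by
      by_contra hq
      exact hc _ (.receive u q st hi (Nat.pos_of_ne_zero hq))
  have hany : ∀ q f, logInstr (ID u) d (c.state u) = .receiveAny f → c.inbox u q = 0 :=
    fun q f hi => by
      by_contra hq
      exact hc _ (.receiveAny u q f hi (Nat.pos_of_ne_zero hq))
  have hcw := h.cw u
  have hccw := h.ccw u
  have hz : c.inbox u .zero = 0 → c.ccwSent (u + 1) = a u := fun h => by
    simp only [Config.inbox] at h; omega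
  have ho : c.inbox u .one = 0 → c.cwSent (u - 1) = r u := fun h => by
    simp only [Config.inbox] at h; omega
  have hp := (h.sound u).possible
  generalize c.state u = st at *
  cases st with
  | syncReceive i k =>
    obtain ⟨h1, h2, h3, h4, h5, h6⟩ := hp
    have := ho (hrec _ _ rfl)
    have := threshold_add h1.1 d
    exact .active i h1 (by omega) (by omega) h5 h6 (.inl (by omega))
  | zeroReceive i k =>
    obtain ⟨h1, h2, h3, h4, h5, h6, h7⟩ := hp
    have hw := H.wave_of_active h1 h2
    have := hw.zeros_eq
    exact .wave i hw (by omega) (by omega) h7 (hz (hrec _ _ rfl))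
  | termReceive =>
    obtain ⟨h1, h2, h3, h4, h5⟩ := hp
    exact .term h1 h4 h5 (hz (hrec _ _ rfl))
  | checkReceive i k =>
    obtain ⟨h1, hb, h2, h2', h3, h4, h5, h6⟩ := hp
    have := ho (hany _ _ rfl)
    exact .active i h1 (by omega) (by omega) h5 h6 (.inr (hz (hany _ _ rfl)))
  | relayReceive killed k =>
    have h1 := ho (hany _ _ rfl)
    have h2 := hz (hany _ _ rfl)
    cases killed
    · obtain ⟨-, i, h3, -, -, h4, -, h5⟩ := hp
      exact .relay (fun hu => not_drops_self i (hu ▸ h3)) (by omega) h5 h2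
    · obtain ⟨⟨i, h3, -⟩, h4, h5, -⟩ := hp
      exact .relay (fun hu => not_drops_self i (hu ▸ h3)) (by omega) h5 h2
  | returned v =>
    cases v
    · exact .returned (by have := hp.2.2.1; omega) hp.2.2.2
    · exact .returned (by have := hp.2.2.1; omega) hp.2.2.2
    · exact hp.elim
  | _ => exact absurd rfl (hsend _ _)

namespace Stuck

variable (hc : Stuck (programs ID d) c) (h : Invariant ID d p₀ e c r a) (H : Setting ID d p₀ e)
include hc h H

theorem received_of_sent (hp : zeros (ID p₀) (len (ID p₀)) < c.ccwSent p₀) :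
    zeros (ID p₀) (len (ID p₀)) < a p₀ := by
  by_contra hn
  have hz : ∀ {u i}, Active ID p₀ u i →
      zeros (ID p₀) (i - 1) < zeros (ID p₀) (len (ID p₀)) :=
    fun hi => H.wave_last.zeros_lt (by have := hi.1; have := hi.2.1; omega)
  obtain ⟨ha, hB⟩ : a p₀ = zeros (ID p₀) (len (ID p₀)) ∧ c.ccwSent (p₀ + 1) = a p₀ := by
    cases hc.blocked h H p₀ with
    | active i hi hs hd ha hb => have := hz hi; omega
    | wave i hi hs ha hb => have := hi.zeros_le; omega
    | relay hu => exact absurd rfl hu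
    | term hu ha hb hB => exact ⟨ha, hB⟩
    | returned ha => exact absurd ha hn
  -- Only `p₀` initiates the last wave; everyone else has received it before sending it on.
  have hall := forall_of_forall_add_one (P := fun u => zeros (ID p₀) (len (ID p₀)) ≤ a u) ha.ge
    fun u hu => by
      rcases eq_or_ne (u + 1) p₀ with he | he
      · rw [he]; exact ha.ge
      · exact H.received_of_sent (h.sound _).possible H.wave_last
          (fun hx => he (H.agree_last _ hx.1)) (hu.trans (h.supply u).ccw_le)
  -- If `p₀ + 1` withholds the termination message, so does each next process, and finally `p₀`,
  -- which has sent it.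
  have := forall_of_forall_add_one (P := fun u => c.ccwSent u ≤ zeros (ID p₀) (len (ID p₀)))
    (p := p₀ + 1) (by omega) (fun u hu => by
      have hau := hall u
      cases hc.blocked h H u with
      | active i hi hs hd ha hb => have := hz hi; omega
      | wave i hi hs ha hb => have := hi.zeros_le; omega
      | relay hu hs hb hB => omega
      | term hu ha hb hB => omega
      | returned ha hb => omega) p₀
  omega

theorem lt_ccwSent : zeros (ID p₀) (len (ID p₀)) < c.ccwSent p₀ := by
  by_contra hn
  have hret : ∀ u, ¬ zeros (ID p₀) (len (ID p₀)) < a u := fun u hu =>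
    hn ((h.terminated_of_received H hu (fun hb => absurd hb hn) (p₀ - 1)).trans_le
      ((Nat.le_add_left _ _).trans_eq (h.ccw_add p₀)))
  have hterm : ∀ {u}, u = p₀ → a u = zeros (ID p₀) (len (ID p₀)) →
      c.ccwSent u = a u + 1 → False := by
    rintro u rfl h1 h2
    omega
  obtain ⟨m, hm⟩ := Finite.exists_min c.cwSent
  -- Otherwise every process at the minimum is a relay, since a blocked active one exceeds its
  -- counter-clockwise neighbour by one. That neighbour is then also at the minimum, and going round
  -- makes `p₀` a relay.
  obtain ⟨z, i, hz, hi, hzs, hza, hzb, hzB⟩ : ∃ z i, c.cwSent z ≤ c.cwSent m ∧ Wave ID p₀ i ∧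
      c.cwSent z = (2 * i - 1) * d ∧ a z + 1 = zeros (ID p₀) i ∧ c.ccwSent z = a z + 1 ∧
      c.ccwSent (z + 1) = a z := by
    by_contra hw
    push Not at hw
    have hstep : ∀ u, c.cwSent u ≤ c.cwSent m → u ≠ p₀ ∧ c.cwSent (u - 1) ≤ c.cwSent m := by
      intro u hu
      cases hc.blocked h H u with
      | active i hi hs hd ha hb => have := hm (u - 1); omega
      | wave i hi hs ha hb hB => exact absurd hB (hw u i hu hi hs ha hb)
      | relay hu' hs hb hB => exact ⟨hu', by omega⟩
      | term hu ha hb => exact (hterm hu ha hb).elim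
      | returned ha => exact (hret u ha).elim
    exact (hstep p₀ (forall_of_forall_sub_one (P := fun u => c.cwSent u ≤ c.cwSent m) le_rfl
      (fun u hu => (hstep u hu).2) p₀)).1 rfl
  -- Minimality of `(2i-1)d` excludes processes stuck in earlier rounds, so the absence of wave `i`
  -- passes clockwise from `z + 1` round to `z`, which has sent it.
  have := forall_of_forall_add_one (P := fun u => c.ccwSent u < zeros (ID p₀) i) (p := z + 1)
    (by omega) (fun u hu => by
      have hmu := hm u
      have hmu' := hm (u - 1)
      cases hc.blocked h H u with
      | active j hj hs hd ha hb hB =>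
        rcases lt_trichotomy j i with hij | rfl | hij
        · have := threshold_lt hij d
          have := H.d_pos
          omega
        · omega
        · have := zeros_mono (ID p₀) (show i ≤ j - 1 by omega)
          omega
      | wave j hj hs ha hb hB =>
        have hij : j < i := lt_of_zeros_lt (x := ID p₀) (by omega)
        have := threshold_lt hij d
        have := threshold_add hj.1 d
        have := H.d_pos
        omega
      | relay hu' hs hb hB => omega
      | term hu ha hb => exact (hterm hu ha hb).elim
      | returned ha => exact (hret u ha).elim) z
  omega

end Stuck

theorem Setting.quiescentlyElects (H : Setting ID d p₀ e) :
    QuiescentlyElects (programs ID d) p₀ where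
  finite := H.finite
  elected c hr hc := by
    obtain ⟨r, a, h⟩ := hr.invariant H
    obtain ⟨h1, h2, h3, -⟩ := h.final H (hc.received_of_sent h H (hc.lt_ccwSent h H))
    exact ⟨h1, h2, h3⟩
  leader_last c v hr hv := by
    obtain ⟨r, a, h⟩ := hr.invariant H
    have hp := (h.sound p₀).possible
    have : zeros (ID p₀) (len (ID p₀)) < a p₀ := by
      simp only [Returned, programs, logarithmicLeaderElection] at hv
      generalize c.state p₀ = st at hv hp
      cases st with
      | returned w =>
        cases w
        · have := hp.2.2.1; omega
        · exact absurd rfl hp.1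
        · exact hp.elim
      | _ => simp [logInstr] at hv
    exact (h.final H this).2.imp_right And.left

/-! ### The number of messages -/

/-- With `L = Nat.log 2 x ≥ 1`, both left sides are at most `3L`, and `L ≤ 2 log x` because `log 2 >
1/2`; hence the constant 6. -/
theorem len_le_mul_log {x : ℕ} (hx : 2 ≤ x) :
    2 * (len x : ℝ) - 1 ≤ 6 * Real.log x ∧ (len x : ℝ) + 1 ≤ 6 * Real.log x := by
  have h2 : (0 : ℝ) < Real.log 2 := Real.log_pos one_lt_two
  have h1 : (1 : ℝ) ≤ Nat.log 2 x := by exact_mod_cast Nat.log_pos one_lt_two hx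
  have h3 : (Nat.log 2 x : ℝ) * Real.log 2 ≤ Real.log x := by
    rw [← Real.log_pow]
    refine Real.log_le_log (by positivity) ?_
    exact_mod_cast Nat.pow_log_le_self 2 (by omega)
  have h4 : 3 * (Nat.log 2 x : ℝ) ≤ 6 * Real.log x := by
    have := Real.log_two_gt_d9
    nlinarith
  simp only [len]
  push_cast
  constructor <;> linarith

end Analysis
end ContentOblivious

theorem mainTheorem3 :
    ∃ C : ℝ, ∀ (n : ℕ) [NeZero n] (ID : Fin n → ℕ) (d : ℕ) (p₀ : Fin n),
      1 ≤ d →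
      Function.Injective ID →
      ContentOblivious.ZeroEnded ID →
      ContentOblivious.StronglyPrefixFree ID →
      ContentOblivious.Scattered d ID →
      (∀ q, ID p₀ ≤ ID q) →
      (∀ q, q ≠ p₀ →
        ContentOblivious.pref (ContentOblivious.len (ID p₀) - 1) (ID q) ≠
          ContentOblivious.pref (ContentOblivious.len (ID p₀) - 1) (ID p₀)) →
      ContentOblivious.QuiescentlyElects
          (fun p => ContentOblivious.logarithmicLeaderElection (ID p) d) p₀ ∧
        ∀ c, ContentOblivious.Reachable
            (fun p => ContentOblivious.logarithmicLeaderElection (ID p) d) c →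
          ContentOblivious.Stuck
            (fun p => ContentOblivious.logarithmicLeaderElection (ID p) d) c →
          ∀ p, c.cwSent p = (2 * ContentOblivious.len (ID p₀) - 1) * d ∧
            c.ccwSent p ≤ ContentOblivious.len (ID p₀) + 1 ∧
            (0 < ID p₀ →
              (c.cwSent p : ℝ) ≤ C * (d * Real.log (ID p₀)) ∧
              (c.ccwSent p : ℝ) ≤ C * Real.log (ID p₀)) := by
  refine ⟨6, fun n _ ID d p₀ hd _ hz hf hs hmin hpre => ?_⟩
  obtain ⟨e, H⟩ := ContentOblivious.exists_setting hd hz hf hs hmin hpre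
  refine ⟨H.quiescentlyElects, fun c hr hc p => ?_⟩
  obtain ⟨r, a, h⟩ := hr.invariant H
  obtain ⟨-, -, -, h1⟩ := h.final H (hc.received_of_sent h H (hc.lt_ccwSent h H))
  have h2 : c.ccwSent p ≤ ContentOblivious.len (ID p₀) + 1 :=
    ((h.sound p).ccwSent_le H).trans (Nat.succ_le_succ (ContentOblivious.zeros_le _ _))
  refine ⟨h1 p, h2, fun hpos => ?_⟩
  -- The identifier 1 is not 0-ended.
  have hx : 2 ≤ ID p₀ := by
    by_contra hx
    have : ID p₀ = 1 := by omega
    have := H.last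
    simp_all [ContentOblivious.bit]
  obtain ⟨h3, h4⟩ := ContentOblivious.len_le_mul_log hx
  constructor
  · have hl := ContentOblivious.len_pos (ID p₀)
    rw [h1 p, Nat.cast_mul, Nat.cast_sub (by omega)]
    push_cast
    calc _ ≤ 6 * Real.log (ID p₀) * d := mul_le_mul_of_nonneg_right h3 (Nat.cast_nonneg d)
      _ = _ := by ring
  · exact le_trans (by exact_mod_cast h2) h4
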